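/- Let $\mathcal X$ and $\mathcal Y$ be complex Banach spaces, let $A$ be a closed, densely defined linear operator from $\operatorname{dom}A\subset\mathcal X$ to $\mathcal Y$, and let $B$ be a closed, densely defined linear operator from $\operatorname{dom}B\subset\mathcal Y$ to $\mathcal X$. The products $AB$ (in $\mathcal Y$) and $BA$ (in $\mathcal X$) are taken on their natural domains $\operatorname{dom}(AB)=\{y\in\operatorname{dom}B : By\in\operatorname{dom}A\}$ and $\operatorname{dom}(BA)=\{x\in\operatorname{dom}A : Ax\in\operatorname{dom}B\}$. For a linear operator $T$ in a Banach space, $\rho(T)$ is the set of $\lambda\in\mathbb C$ such that $T-\lambda$ maps $\operatorname{dom}T$ bijectively onto the space and has a bounded inverse. An operator is upper (lower) semi-Fredholm if its range is closed and its kernel is finite-dimensional (its range is closed and finite-codimensional), and Fredholm if it is both. Further, - $\sigma_{\rm ap}(T)$ is the set of $\lambda\in\mathbb C$ for which there are $x_n\in\operatorname{dom}T$ with $\|x_n\|=1$ and $(T-\lambda)x_n\to0$; - $\sigma_{\rm c}(T)$ is the set of $\lambda\in\mathbb C$ for which $T-\lambda$ is injective with dense range but not surjective; - $\sigma_{\rm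 r}(T)$ is the set of $\lambda\in\mathbb C$ for which $T-\lambda$ is injective and its range is not dense; - $\sigma_{\rm ess}(T)$ is the set of $\lambda\in\mathbb C$ for which $T-\lambda$ is not Fredholm. Suppose that $\rho(AB)$ and $\rho(BA)$ are non-empty. Then for every $\lambda\in\mathbb C\setminus\{0\}$: (i) $\operatorname{ran}(AB-\lambda)$ is closed if and only if $\operatorname{ran}(BA-\lambda)$ is closed; (ii) $\operatorname{ran}(AB-\lambda)$ is dense in $\mathcal Y$ if and only if $\operatorname{ran}(BA-\lambda)$ is dense in $\mathcal X$; (iii) $AB-\lambda$ is upper semi-Fredholm if and only if $BA-\lambda$ is upper semi-Fredholm; (iv) $AB-\lambda$ is lower semi-Fredholm if and only if $BA-\lambda$ is lower semi-Fredholm. In consequence, $$\sigma_{\rm ap}(AB)\setminus\{0\}=\sigma_{\rm ap}(BA)\setminus\{0\},\qquad \sigma_{\rm c}(AB)\setminus\{0\}=\sigma_{\rm c}(BA)\setminus\{0\},$$ $$\sigma_{\rm r}(AB)\setminus\{0\}=\sigma_{\rm r}(BA)\setminus\{0\},\qquad \sigma_{\rm ess}(AB)\setminus\{0\}=\sigma_{\rm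 ess}(BA)\setminus\{0\}.$$ -/

import Mathlib

namespace LinearPMap

section Product

variable {E F G : Type*} [AddCommGroup E] [Module ℂ E] [AddCommGroup F] [Module ℂ F]
  [AddCommGroup G] [Module ℂ G]

/-- The domain `{x ∈ dom S : S x ∈ dom T}` of the product `T S`. -/
def prodDomain (T : F →ₗ.[ℂ] G) (S : E →ₗ.[ℂ] F) : Submodule ℂ E :=
  (T.domain.comap S.toFun).map S.domain.subtype

theorem mem_prodDomain (T : F →ₗ.[ℂ] G) (S : E →ₗ.[ℂ] F) (x : E) :
    x ∈ T.prodDomain S ↔ ∃ h : x ∈ S.domain, S ⟨x, h⟩ ∈ T.domain := by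
  simp [prodDomain]

theorem prodDomain_le (T : F →ₗ.[ℂ] G) (S : E →ₗ.[ℂ] F) : T.prodDomain S ≤ S.domain :=
  fun x hx => ((mem_prodDomain T S x).1 hx).1

/-- The product `T S` of two unbounded operators on its natural domain
`{x ∈ dom S : S x ∈ dom T}`, given there by `x ↦ T (S x)`. -/
def product (T : F →ₗ.[ℂ] G) (S : E →ₗ.[ℂ] F) : E →ₗ.[ℂ] G where
  domain := T.prodDomain S
  toFun := T.toFun ∘ₗ
    (S.toFun ∘ₗ Submodule.inclusion (prodDomain_le T S)).codRestrict T.domain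
      (fun x => ((mem_prodDomain T S x).1 x.2).2)

/-- The operator `T - z`, with the same domain as `T`. -/
def subScalar (T : E →ₗ.[ℂ] E) (z : ℂ) : E →ₗ.[ℂ] E where
  domain := T.domain
  toFun := T.toFun - z • T.domain.subtype

theorem product_apply (T : F →ₗ.[ℂ] G) (S : E →ₗ.[ℂ] F) (x : E) (hx : x ∈ S.domain)
    (hSx : S ⟨x, hx⟩ ∈ T.domain) :
    T.product S ⟨x, (mem_prodDomain T S x).2 ⟨hx, hSx⟩⟩ = T ⟨S ⟨x, hx⟩, hSx⟩ := rfl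

theorem subScalar_apply (T : E →ₗ.[ℂ] E) (z : ℂ) (x : T.domain) :
    T.subScalar z x = T x - z • (x : E) := rfl

/-- The kernel of `T`, as a subspace of its domain. -/
def kernel (T : E →ₗ.[ℂ] F) : Submodule ℂ T.domain := LinearMap.ker T.toFun

/-- The range of `T`. -/
def ran (T : E →ₗ.[ℂ] F) : Submodule ℂ F := LinearMap.range T.toFun

end Product

section Spectra

variable {E F : Type*} [NormedAddCommGroup E] [NormedSpace ℂ E]
  [NormedAddCommGroup F] [NormedSpace ℂ F]

/-- The resolvent set: `T - z` maps `dom T` bijectively onto the space, and its inverse is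
a bounded operator. -/
def resolventSet (T : E →ₗ.[ℂ] E) : Set ℂ :=
  {z | Function.Bijective (T.subScalar z) ∧
    ∃ R : E →L[ℂ] E, ∀ x : T.domain, R (T.subScalar z x) = x}

/-- The approximate point spectrum. -/
def approxPointSpectrum (T : E →ₗ.[ℂ] E) : Set ℂ :=
  {z | ∃ x : ℕ → T.domain, (∀ n, ‖(x n : E)‖ = 1) ∧
    Filter.Tendsto (fun n => T.subScalar z (x n)) Filter.atTop (nhds 0)}

/-- The continuous spectrum: `T - z` is injective with dense range, but not surjective. -/
def continuousSpectrum (T : E →ₗ.[ℂ] E) : Set ℂ :=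
  {z | (T.subScalar z).kernel = ⊥ ∧ Dense ((T.subScalar z).ran : Set E) ∧
    (T.subScalar z).ran ≠ ⊤}

/-- The residual spectrum: `T - z` is injective, but its range is not dense. -/
def residualSpectrum (T : E →ₗ.[ℂ] E) : Set ℂ :=
  {z | (T.subScalar z).kernel = ⊥ ∧ ¬ Dense ((T.subScalar z).ran : Set E)}

/-- Closed range and finite-dimensional kernel. -/
def IsUpperSemiFredholm (T : E →ₗ.[ℂ] F) : Prop :=
  _root_.IsClosed (T.ran : Set F) ∧ FiniteDimensional ℂ T.kernel

/-- Closed range of finite codimension. -/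
def IsLowerSemiFredholm (T : E →ₗ.[ℂ] F) : Prop :=
  _root_.IsClosed (T.ran : Set F) ∧ FiniteDimensional ℂ (F ⧸ T.ran)

/-- Both upper and lower semi-Fredholm. -/
def IsFredholmOperator (T : E →ₗ.[ℂ] F) : Prop :=
  T.IsUpperSemiFredholm ∧ T.IsLowerSemiFredholm

/-- The essential spectrum: all `z` for which `T - z` is not Fredholm. -/
def essentialSpectrum (T : E →ₗ.[ℂ] E) : Set ℂ :=
  {z | ¬ (T.subScalar z).IsFredholmOperator}

end Spectra

end LinearPMap

/-! Regard `P = AB - z` and `Q = BA - z`, for `z ≠ 0`, as complexes `dom P → Y` and `dom Q → X` of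
length two. For `μ ∈ ρ(AB)` and `ν ∈ ρ(BA)` the closed graph theorem makes `K = B (AB - μ)⁻¹` and
`L = A (BA - ν)⁻¹` bounded. They intertwine the operators, `K P ⊆ Q K` and `L Q ⊆ P L`, so they
are chain maps, and `z⁻¹ (z - μ) (z - ν) L K` is homotopic to the identity: with the bounded
operator `T = z⁻¹ (μ (AB - μ)⁻¹ + (z - μ) L K)` the difference is `P T` on `Y` and `T P` on `dom P`.
So each of `P` and `Q` is a retract of the other up to homotopy, and all the properties in question
pass from `Q` to its homotopy retract `P`. -/

section Graph

variable {E F G : Type*} [AddCommGroup E] [Module ℂ E] [AddCommGroup F] [Module ℂ F]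
  [AddCommGroup G] [Module ℂ G]

theorem mem_graph_product_iff {T : F →ₗ.[ℂ] G} {S : E →ₗ.[ℂ] F} {x : E} {w : G} :
    (x, w) ∈ (T.product S).graph ↔ ∃ y, (x, y) ∈ S.graph ∧ (y, w) ∈ T.graph := by
  constructor
  · intro h
    obtain ⟨⟨u, hu⟩, rfl, rfl⟩ := (LinearPMap.mem_graph_iff _).1 h
    obtain ⟨huS, huT⟩ := (LinearPMap.mem_prodDomain T S u).1 hu
    exact ⟨S ⟨u, huS⟩, S.mem_graph ⟨u, huS⟩, T.mem_graph ⟨S ⟨u, huS⟩, huT⟩⟩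
  · rintro ⟨y, hxy, hyw⟩
    have hx := LinearPMap.mem_domain_of_mem_graph hxy
    have hy := LinearPMap.mem_domain_of_mem_graph hyw
    obtain rfl := (LinearPMap.image_iff hx).2 hxy
    obtain rfl := (LinearPMap.image_iff hy).2 hyw
    exact (T.product S).mem_graph ⟨x, (LinearPMap.mem_prodDomain T S x).2 ⟨hx, hy⟩⟩

theorem mem_graph_subScalar_iff {T : E →ₗ.[ℂ] E} {z : ℂ} {x w : E} :
    (x, w) ∈ (T.subScalar z).graph ↔ (x, w + z • x) ∈ T.graph := by
  simp only [LinearPMap.mem_graph_iff]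
  refine exists_congr fun u => and_congr_right fun hu => ?_
  rw [← hu]
  exact sub_eq_iff_eq_add

theorem mem_ran_iff {T : E →ₗ.[ℂ] F} {w : F} : w ∈ T.ran ↔ ∃ x, (x, w) ∈ T.graph :=
  LinearPMap.mem_range_iff

end Graph

section BoundedBelow

variable {E F : Type*} [NormedAddCommGroup E] [NormedSpace ℂ E]
  [NormedAddCommGroup F] [NormedSpace ℂ F]

/-- The unbounded operator `T` is bounded below: `‖x‖ ≤ C ‖T x‖` on its domain, for some `C`. -/
def IsBoundedBelow (T : E →ₗ.[ℂ] F) : Prop :=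
  ∃ C : ℝ, ∀ x : T.domain, ‖(x : E)‖ ≤ C * ‖T x‖

theorem exists_norm_eq_one_of_not_isBoundedBelow {T : E →ₗ.[ℂ] F} (hT : ¬ IsBoundedBelow T)
    {ε : ℝ} (hε : 0 < ε) : ∃ x : T.domain, ‖(x : E)‖ = 1 ∧ ‖T x‖ ≤ ε := by
  simp only [IsBoundedBelow, not_exists, not_forall, not_le] at hT
  obtain ⟨u, hu⟩ := hT ε⁻¹
  have hpos : 0 < ‖(u : E)‖ := lt_of_le_of_lt (by positivity) hu
  refine ⟨((‖(u : E)‖⁻¹ : ℝ) : ℂ) • u, ?_, ?_⟩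
  · rw [Submodule.coe_smul, norm_smul, Complex.norm_real, norm_inv, norm_norm,
      inv_mul_cancel₀ hpos.ne']
  · rw [T.map_smul, norm_smul, Complex.norm_real, norm_inv, norm_norm, inv_mul_le_iff₀ hpos,
      mul_comm, ← inv_mul_le_iff₀ hε]
    exact hu.le

theorem notMem_approxPointSpectrum_iff {T : E →ₗ.[ℂ] E} {z : ℂ} :
    z ∉ T.approxPointSpectrum ↔ IsBoundedBelow (T.subScalar z) := by
  constructor
  · contrapose!
    intro hT
    choose x hx_norm hx_image using fun n : ℕ =>
      exists_norm_eq_one_of_not_isBoundedBelow hT (Nat.one_div_pos_of_nat (n := n) (α := ℝ))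
    exact ⟨x, hx_norm, squeeze_zero_norm hx_image tendsto_one_div_add_atTop_nhds_zero_nat⟩
  · rintro ⟨C, hC⟩ ⟨x, hx_norm, hx_image⟩
    have hlim : Filter.Tendsto (fun n => C * ‖T.subScalar z (x n)‖) Filter.atTop (nhds 0) := by
      simpa only [norm_zero, mul_zero] using hx_image.norm.const_mul C
    exact zero_lt_one.not_ge (ge_of_tendsto' hlim fun n => (hx_norm n).ge.trans (hC (x n)))

end BoundedBelow

section HomotopyRetract

variable {X Y : Type*} [NormedAddCommGroup X] [NormedSpace ℂ X]
  [NormedAddCommGroup Y] [NormedSpace ℂ Y]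

/-- Bounded operators exhibiting `P` as a retract of `Q` up to homotopy, where an operator is
regarded as a complex of length two from its domain to the space: `incl` and `retr` are chain maps,
and `homotopy` joins `retr ∘ incl` to the identity. -/
structure HomotopyRetract (P : Y →ₗ.[ℂ] Y) (Q : X →ₗ.[ℂ] X) where
  incl : Y →L[ℂ] X
  retr : X →L[ℂ] Y
  homotopy : Y →L[ℂ] Y
  incl_mem_graph {u f : Y} : (u, f) ∈ P.graph → (incl u, incl f) ∈ Q.graph
  retr_mem_graph {x w : X} : (x, w) ∈ Q.graph → (retr x, retr w) ∈ P.graph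
  homotopy_mem_graph (y : Y) : (homotopy y, y - retr (incl y)) ∈ P.graph
  homotopy_eq {u f : Y} : (u, f) ∈ P.graph → homotopy f = u - retr (incl u)

namespace HomotopyRetract

variable {P : Y →ₗ.[ℂ] Y} {Q : X →ₗ.[ℂ] X}

theorem retr_mem_ran (h : HomotopyRetract P Q) {w : X} (hw : w ∈ Q.ran) : h.retr w ∈ P.ran := by
  obtain ⟨x, hx⟩ := mem_ran_iff.1 hw
  exact mem_ran_iff.2 ⟨_, h.retr_mem_graph hx⟩

theorem sub_retr_incl_mem_ran (h : HomotopyRetract P Q) (y : Y) :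
    y - h.retr (h.incl y) ∈ P.ran :=
  mem_ran_iff.2 ⟨_, h.homotopy_mem_graph y⟩

theorem ran_eq_comap (h : HomotopyRetract P Q) : P.ran = Q.ran.comap h.incl.toLinearMap := by
  ext y
  constructor
  · intro hy
    obtain ⟨u, hu⟩ := mem_ran_iff.1 hy
    exact mem_ran_iff.2 ⟨_, h.incl_mem_graph hu⟩
  · intro hy
    exact (Submodule.sub_mem_iff_left _ (h.retr_mem_ran hy)).1 (h.sub_retr_incl_mem_ran y)

theorem isClosed_ran (h : HomotopyRetract P Q) (hQ : IsClosed (Q.ran : Set X)) :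
    IsClosed (P.ran : Set Y) := by
  rw [h.ran_eq_comap]
  exact hQ.preimage h.incl.continuous

theorem ran_eq_top (h : HomotopyRetract P Q) (hQ : Q.ran = ⊤) : P.ran = ⊤ := by
  rw [h.ran_eq_comap, hQ, Submodule.comap_top]

theorem dense_ran (h : HomotopyRetract P Q) (hQ : Dense (Q.ran : Set X)) :
    Dense (P.ran : Set Y) := by
  intro y
  have hmaps : Set.MapsTo h.retr (Q.ran : Set X) (P.ran : Set Y) := fun _ => h.retr_mem_ran
  have hretr : h.retr (h.incl y) ∈ P.ran.topologicalClosure :=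
    hmaps.closure h.retr.continuous (hQ (h.incl y))
  exact (Submodule.sub_mem_iff_left _ hretr).1
    (P.ran.le_topologicalClosure (h.sub_retr_incl_mem_ran y))

theorem finiteDimensional_quotient_ran (h : HomotopyRetract P Q)
    (hQ : FiniteDimensional ℂ (X ⧸ Q.ran)) : FiniteDimensional ℂ (Y ⧸ P.ran) := by
  refine FiniteDimensional.of_injective
    (Submodule.mapQ P.ran Q.ran h.incl.toLinearMap h.ran_eq_comap.le) ?_
  rw [← LinearMap.ker_eq_bot, Submodule.ker_mapQ, ← h.ran_eq_comap, Submodule.mkQ_map_self]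

theorem incl_mem_domain (h : HomotopyRetract P Q) (u : P.domain) : h.incl u ∈ Q.domain :=
  LinearPMap.mem_domain_of_mem_graph (h.incl_mem_graph (P.mem_graph u))

theorem apply_incl (h : HomotopyRetract P Q) (u : P.domain) :
    Q ⟨h.incl u, h.incl_mem_domain u⟩ = h.incl (P u) :=
  ((LinearPMap.image_iff (h.incl_mem_domain u)).2 (h.incl_mem_graph (P.mem_graph u))).symm

/-- The map induced by `incl` on kernels, that is, on the homology in degree one. -/
def kernelMap (h : HomotopyRetract P Q) : P.kernel →ₗ[ℂ] Q.kernel :=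
  LinearMap.restrict
    ((h.incl.toLinearMap ∘ₗ P.domain.subtype).codRestrict Q.domain h.incl_mem_domain)
    fun u hu => by
      have hPu : P u = 0 := hu
      exact (h.apply_incl u).trans (by rw [hPu, map_zero])

theorem kernelMap_injective (h : HomotopyRetract P Q) : Function.Injective h.kernelMap := by
  rw [injective_iff_map_eq_zero]
  rintro ⟨u, hu⟩ hmap
  have hPu : P u = 0 := hu
  have hincl : h.incl u = 0 := congrArg (fun x : Q.kernel => ((x : Q.domain) : X)) hmap
  have hhomotopy := h.homotopy_eq (P.mem_graph u)
  rw [hPu, hincl, map_zero, map_zero, sub_zero] at hhomotopy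
  exact Subtype.ext (Subtype.ext hhomotopy.symm)

theorem kernel_eq_bot (h : HomotopyRetract P Q) (hQ : Q.kernel = ⊥) : P.kernel = ⊥ := by
  rw [← Submodule.subsingleton_iff_eq_bot] at hQ ⊢
  exact h.kernelMap_injective.subsingleton

theorem isUpperSemiFredholm (h : HomotopyRetract P Q) (hQ : Q.IsUpperSemiFredholm) :
    P.IsUpperSemiFredholm :=
  have := hQ.2
  ⟨h.isClosed_ran hQ.1, FiniteDimensional.of_injective h.kernelMap h.kernelMap_injective⟩

theorem isLowerSemiFredholm (h : HomotopyRetract P Q) (hQ : Q.IsLowerSemiFredholm) :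
    P.IsLowerSemiFredholm :=
  ⟨h.isClosed_ran hQ.1, h.finiteDimensional_quotient_ran hQ.2⟩

theorem isBoundedBelow (h : HomotopyRetract P Q) (hQ : IsBoundedBelow Q) : IsBoundedBelow P := by
  obtain ⟨C, hC⟩ := hQ
  refine ⟨‖h.retr‖ * (|C| * ‖h.incl‖) + ‖h.homotopy‖, fun u => ?_⟩
  have hincl : ‖h.incl u‖ ≤ |C| * (‖h.incl‖ * ‖P u‖) :=
    calc ‖h.incl u‖ ≤ C * ‖h.incl (P u)‖ := by
          simpa only [h.apply_incl] using hC ⟨h.incl u, h.incl_mem_domain u⟩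
      _ ≤ |C| * (‖h.incl‖ * ‖P u‖) := by
          gcongr
          exacts [le_abs_self C, h.incl.le_opNorm _]
  calc ‖(u : Y)‖ = ‖h.retr (h.incl u) + h.homotopy (P u)‖ := by
        rw [h.homotopy_eq (P.mem_graph u), add_sub_cancel]
    _ ≤ ‖h.retr‖ * ‖h.incl u‖ + ‖h.homotopy‖ * ‖P u‖ :=
        norm_add_le_of_le (h.retr.le_opNorm _) (h.homotopy.le_opNorm _)
    _ ≤ ‖h.retr‖ * (|C| * (‖h.incl‖ * ‖P u‖)) + ‖h.homotopy‖ * ‖P u‖ := by gcongr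
    _ = (‖h.retr‖ * (|C| * ‖h.incl‖) + ‖h.homotopy‖) * ‖P u‖ := by ring

end HomotopyRetract

end HomotopyRetract

section ProductResolvent

variable {X Y : Type*} [NormedAddCommGroup X] [NormedSpace ℂ X]
  [NormedAddCommGroup Y] [NormedSpace ℂ Y]

/-- The bounded operators `inv = (AB - μ)⁻¹` and `snd = B (AB - μ)⁻¹`, characterized through the
graphs of `A` and `B`. -/
structure ProductResolvent (A : X →ₗ.[ℂ] Y) (B : Y →ₗ.[ℂ] X) (μ : ℂ) where
  inv : Y →L[ℂ] Y
  snd : Y →L[ℂ] X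
  inv_mem_graph (y : Y) : (inv y, snd y) ∈ B.graph
  snd_mem_graph (y : Y) : (snd y, y + μ • inv y) ∈ A.graph
  inv_sub {u v : Y} : (u, v) ∈ (A.product B).graph → inv v - μ • inv u = u

theorem continuous_comp_of_isClosed {E : Type*} [NormedAddCommGroup E] [NormedSpace ℂ E]
    [CompleteSpace E] [CompleteSpace X] {B : Y →ₗ.[ℂ] X} (hB : B.IsClosed) (R : E →L[ℂ] Y)
    (hR : ∀ y, R y ∈ B.domain) :
    Continuous (B.toFun ∘ₗ R.toLinearMap.codRestrict B.domain hR) := by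
  refine LinearMap.continuous_of_seq_closed_graph _ fun u y x hu hx => ?_
  have hlim := ((R.continuous.tendsto y).comp hu).prodMk_nhds hx
  have hyx : (R y, x) ∈ B.graph :=
    IsClosed.mem_of_tendsto hB hlim (.of_forall fun n => B.mem_graph ⟨R (u n), hR (u n)⟩)
  exact (LinearPMap.image_iff (hR y)).2 hyx

theorem nonempty_productResolvent [CompleteSpace X] [CompleteSpace Y] (A : X →ₗ.[ℂ] Y)
    {B : Y →ₗ.[ℂ] X} (hB : B.IsClosed) {μ : ℂ} (hμ : μ ∈ (A.product B).resolventSet) :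
    Nonempty (ProductResolvent A B μ) := by
  obtain ⟨⟨-, hsurj⟩, R, hR⟩ := hμ
  have hR_mem (y : Y) : ∃ x, (R y, x) ∈ B.graph ∧ (x, y + μ • R y) ∈ A.graph := by
    obtain ⟨u, rfl⟩ := hsurj y
    rw [hR u, ← mem_graph_product_iff, ← mem_graph_subScalar_iff]
    exact ((A.product B).subScalar μ).mem_graph u
  have hR_dom (y : Y) : R y ∈ B.domain := by
    obtain ⟨x, hx, -⟩ := hR_mem y
    exact LinearPMap.mem_domain_of_mem_graph hx
  refine ⟨⟨R, ⟨_, continuous_comp_of_isClosed hB R hR_dom⟩, fun y => B.mem_graph ⟨R y, hR_dom y⟩,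
    fun y => ?_, fun {u v} huv => ?_⟩⟩
  · obtain ⟨x, hx, hxA⟩ := hR_mem y
    rwa [(LinearPMap.image_iff (hR_dom y)).2 hx] at hxA
  · have huv' : (u, v - μ • u) ∈ ((A.product B).subScalar μ).graph := by
      rwa [mem_graph_subScalar_iff, sub_add_cancel]
    have hu := LinearPMap.mem_domain_of_mem_graph huv'
    rw [← map_smul, ← map_sub, (LinearPMap.image_iff hu).2 huv']
    exact hR ⟨u, hu⟩

namespace ProductResolvent

variable {A : X →ₗ.[ℂ] Y} {B : Y →ₗ.[ℂ] X} {μ ν z : ℂ}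

theorem snd_mem_graph_inv (r : ProductResolvent A B μ) {u v : Y}
    (huv : (u, v) ∈ (A.product B).graph) : (r.snd u, r.inv v) ∈ A.graph := by
  rw [sub_eq_iff_eq_add.1 (r.inv_sub huv)]
  exact r.snd_mem_graph u

theorem snd_sub (r : ProductResolvent A B μ) {u v : Y} {x : X} (hux : (u, x) ∈ B.graph)
    (hxv : (x, v) ∈ A.graph) : r.snd v - μ • r.snd u = x := by
  have huv := r.inv_sub (mem_graph_product_iff.2 ⟨x, hux, hxv⟩)
  exact LinearPMap.mem_graph_snd_inj B
    (B.graph.sub_mem (r.inv_mem_graph v) (B.graph.smul_mem μ (r.inv_mem_graph u))) hux huv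

theorem snd_mem_graph_subScalar (r : ProductResolvent A B μ) {u f : Y}
    (huf : (u, f) ∈ ((A.product B).subScalar z).graph) :
    (r.snd u, r.snd f) ∈ ((B.product A).subScalar z).graph := by
  rw [mem_graph_subScalar_iff] at huf ⊢
  rw [← map_smul, ← map_add]
  exact mem_graph_product_iff.2 ⟨_, r.snd_mem_graph_inv huf, r.inv_mem_graph _⟩

theorem homotopy_mem_graph (r : ProductResolvent A B μ) (s : ProductResolvent B A ν) (y : Y) :
    (μ • r.inv y + (z - μ) • s.snd (r.snd y),
      z • y - ((z - μ) * (z - ν)) • s.snd (r.snd y)) ∈ ((A.product B).subScalar z).graph := by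
  rw [mem_graph_subScalar_iff, mem_graph_product_iff]
  refine ⟨z • r.snd y + (ν * (z - μ)) • s.inv (r.snd y), ?_, ?_⟩
  · convert B.graph.add_mem (B.graph.smul_mem μ (r.inv_mem_graph y))
      (B.graph.smul_mem (z - μ) (s.snd_mem_graph (r.snd y))) using 1
    ext
    · rfl
    · dsimp only [Prod.snd_add, Prod.smul_snd]
      module
  · convert A.graph.add_mem (A.graph.smul_mem z (r.snd_mem_graph y))
      (A.graph.smul_mem (ν * (z - μ)) (s.inv_mem_graph (r.snd y))) using 1
    ext
    · rfl
    · dsimp only [Prod.snd_add, Prod.smul_snd]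
      module

theorem homotopy_eq (r : ProductResolvent A B μ) (s : ProductResolvent B A ν) {u f : Y}
    (huf : (u, f) ∈ ((A.product B).subScalar z).graph) :
    μ • r.inv f + (z - μ) • s.snd (r.snd f) =
      z • u - ((z - μ) * (z - ν)) • s.snd (r.snd u) := by
  rw [mem_graph_subScalar_iff] at huf
  have hinv := r.inv_sub huf
  have hsnd := s.snd_sub (r.snd_mem_graph_inv huf) (r.inv_mem_graph _)
  simp only [map_add, map_smul] at hinv hsnd
  linear_combination (norm := module) μ • hinv + (z - μ) • (hsnd + hinv)

/-- The homotopy retraction given by `(z - μ) B (AB - μ)⁻¹` and `z⁻¹ (z - ν) A (BA - ν)⁻¹`. -/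
noncomputable def homotopyRetract (r : ProductResolvent A B μ) (s : ProductResolvent B A ν)
    (hz : z ≠ 0) :
    HomotopyRetract ((A.product B).subScalar z) ((B.product A).subScalar z) where
  incl := (z - μ) • r.snd
  retr := (z⁻¹ * (z - ν)) • s.snd
  homotopy := z⁻¹ • (μ • r.inv + (z - μ) • s.snd ∘L r.snd)
  incl_mem_graph huf := Submodule.smul_mem _ (z - μ) (r.snd_mem_graph_subScalar huf)
  retr_mem_graph hxw := Submodule.smul_mem _ (z⁻¹ * (z - ν)) (s.snd_mem_graph_subScalar hxw)
  homotopy_mem_graph y := by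
    convert Submodule.smul_mem _ z⁻¹ (r.homotopy_mem_graph s (z := z) y) using 1
    ext
    · rfl
    · simp only [smul_apply, map_smul, Prod.smul_snd, smul_sub, inv_smul_smul₀ hz]
      module
  homotopy_eq {u f} huf := by
    change z⁻¹ • (μ • r.inv f + (z - μ) • s.snd (r.snd f)) = _
    rw [r.homotopy_eq s huf, smul_sub, inv_smul_smul₀ hz]
    simp only [smul_apply, map_smul]
    module

end ProductResolvent

end ProductResolvent

theorem theoremp_general {X Y : Type*}
    [NormedAddCommGroup X] [NormedSpace ℂ X] [CompleteSpace X]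
    [NormedAddCommGroup Y] [NormedSpace ℂ Y] [CompleteSpace Y]
    (A : X →ₗ.[ℂ] Y) (B : Y →ₗ.[ℂ] X)
    (hA : A.IsClosed) (hB : B.IsClosed)
    (hAB : (A.product B).resolventSet.Nonempty)
    (hBA : (B.product A).resolventSet.Nonempty) :
    (∀ z : ℂ, z ≠ 0 →
      (IsClosed (((A.product B).subScalar z).ran : Set Y) ↔
        IsClosed (((B.product A).subScalar z).ran : Set X)) ∧
      (Dense (((A.product B).subScalar z).ran : Set Y) ↔
        Dense (((B.product A).subScalar z).ran : Set X)) ∧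
      (((A.product B).subScalar z).IsUpperSemiFredholm ↔
        ((B.product A).subScalar z).IsUpperSemiFredholm) ∧
      (((A.product B).subScalar z).IsLowerSemiFredholm ↔
        ((B.product A).subScalar z).IsLowerSemiFredholm)) ∧
    (A.product B).approxPointSpectrum \ {0} = (B.product A).approxPointSpectrum \ {0} ∧
    (A.product B).continuousSpectrum \ {0} = (B.product A).continuousSpectrum \ {0} ∧
    (A.product B).residualSpectrum \ {0} = (B.product A).residualSpectrum \ {0} ∧
    (A.product B).essentialSpectrum \ {0} = (B.product A).essentialSpectrum \ {0} := by
  obtain ⟨μ, hμ⟩ := hAB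
  obtain ⟨ν, hν⟩ := hBA
  obtain ⟨r⟩ := nonempty_productResolvent A hB hμ
  obtain ⟨s⟩ := nonempty_productResolvent B hA hν
  have hr {z : ℂ} (hz : z ≠ 0) := r.homotopyRetract s hz
  have hs {z : ℂ} (hz : z ≠ 0) := s.homotopyRetract r hz
  have hclosed {z : ℂ} (hz : z ≠ 0) := Iff.intro (hs hz).isClosed_ran (hr hz).isClosed_ran
  have hdense {z : ℂ} (hz : z ≠ 0) := Iff.intro (hs hz).dense_ran (hr hz).dense_ran
  have hupper {z : ℂ} (hz : z ≠ 0) :=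
    Iff.intro (hs hz).isUpperSemiFredholm (hr hz).isUpperSemiFredholm
  have hlower {z : ℂ} (hz : z ≠ 0) :=
    Iff.intro (hs hz).isLowerSemiFredholm (hr hz).isLowerSemiFredholm
  have hbelow {z : ℂ} (hz : z ≠ 0) := Iff.intro (hs hz).isBoundedBelow (hr hz).isBoundedBelow
  have hkernel {z : ℂ} (hz : z ≠ 0) := Iff.intro (hs hz).kernel_eq_bot (hr hz).kernel_eq_bot
  have hsurj {z : ℂ} (hz : z ≠ 0) := Iff.intro (hs hz).ran_eq_top (hr hz).ran_eq_top
  refine ⟨fun z hz => ⟨hclosed hz, hdense hz, hupper hz, hlower hz⟩, ?_, ?_, ?_, ?_⟩ <;>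
    refine Set.ext fun z => and_congr_left fun hz => ?_
  · rw [← not_iff_not, notMem_approxPointSpectrum_iff, notMem_approxPointSpectrum_iff, hbelow hz]
  · exact and_congr (hkernel hz) (and_congr (hdense hz) (not_congr (hsurj hz)))
  · exact and_congr (hkernel hz) (not_congr (hdense hz))
  · exact not_congr (and_congr (hupper hz) (hlower hz))

theorem theoremp {X Y : Type*}
    [NormedAddCommGroup X] [NormedSpace ℂ X] [CompleteSpace X]
    [NormedAddCommGroup Y] [NormedSpace ℂ Y] [CompleteSpace Y]
    (A : X →ₗ.[ℂ] Y) (B : Y →ₗ.[ℂ] X)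
    (hA : A.IsClosed) (hAd : Dense (A.domain : Set X))
    (hB : B.IsClosed) (hBd : Dense (B.domain : Set Y))
    (hAB : (A.product B).resolventSet.Nonempty)
    (hBA : (B.product A).resolventSet.Nonempty) :
    (∀ z : ℂ, z ≠ 0 →
      (IsClosed (((A.product B).subScalar z).ran : Set Y) ↔
        IsClosed (((B.product A).subScalar z).ran : Set X)) ∧
      (Dense (((A.product B).subScalar z).ran : Set Y) ↔
        Dense (((B.product A).subScalar z).ran : Set X)) ∧
      (((A.product B).subScalar z).IsUpperSemiFredholm ↔
        ((B.product A).subScalar z).IsUpperSemiFredholm) ∧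
      (((A.product B).subScalar z).IsLowerSemiFredholm ↔
        ((B.product A).subScalar z).IsLowerSemiFredholm)) ∧
    (A.product B).approxPointSpectrum \ {0} = (B.product A).approxPointSpectrum \ {0} ∧
    (A.product B).continuousSpectrum \ {0} = (B.product A).continuousSpectrum \ {0} ∧
    (A.product B).residualSpectrum \ {0} = (B.product A).residualSpectrum \ {0} ∧
    (A.product B).essentialSpectrum \ {0} = (B.product A).essentialSpectrum \ {0} :=
  theoremp_general A B hA hB hAB hBA
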